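/- All graphs are finite and simple. For a graph $G$ let $I(G;x)=\sum_{k=0}^{\alpha(G)} i_k(G)\,x^k$ be its independence polynomial, where $i_k(G)$ is the number of independent sets of $k$ vertices of $G$ and $\alpha(G)$ is the largest size of an independent set. For a vertex $v$ of $G$ and an integer $n\ge 0$, let the $n$-concatenation $P_n(G,v)$ be the graph obtained from $n$ disjoint copies of $G$ by adding the $n-1$ edges of a path (none if $n\le 1$) that runs through the $n$ copies of the vertex $v$ in order; in other words, each vertex of the path with $n$ vertices is identified with the vertex $v$ of its own copy of $G$. A graph is claw-free if it has no induced subgraph isomorphic to $K_{1,3}$. (i) If $G$ is claw-free, then for every vertex $v$ of $G$ and every $n\ge 0$ all complex zeros of $I(P_n(G,v);x)$ are real. (ii) The graph $P_n(G,v)$ itself need not be claw-free: for every $n\ge 2$ there are a claw-free graph $G$ and a vertex $v$ of $G$ such that $P_n(G,v)$ is not claw-free. -/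

import Mathlib

namespace SimpleGraph

/-- `G` is claw-free: no induced subgraph of `G` is isomorphic to the claw `K_{1,3}`. -/
def IsClawFree {V : Type*} (G : SimpleGraph V) : Prop :=
  ¬ (completeBipartiteGraph (Fin 1) (Fin 3)).IsIndContained G

open Classical in
/-- The independence polynomial `∑_{k=0}^{α(G)} i_k(G) x^k` of a finite graph, where `i_k(G)` is
the number of independent sets of cardinality `k` and `α(G)` is the independence number. -/
noncomputable def indepPoly {V : Type*} [Fintype V] (G : SimpleGraph V) : Polynomial ℝ :=
  ∑ k ∈ Finset.range (G.indepNum + 1),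
    Polynomial.C ((G.indepSetFinset k).card : ℝ) * Polynomial.X ^ k

/-- The `n`-concatenation `P_n(G, v)`: `n` disjoint copies of `G` (the `i`-th one being
`{i} × V`), in which the copies of `v` are moreover joined as the vertices of the path `P_n`. -/
def concatenation {V : Type*} (n : ℕ) (G : SimpleGraph V) (v : V) :
    SimpleGraph (Fin n × V) where
  Adj p q := (p.1 = q.1 ∧ G.Adj p.2 q.2) ∨
    (p.2 = v ∧ q.2 = v ∧ (pathGraph n).Adj p.1 q.1)
  symm := ⟨fun _ _ h => h.elim (fun h => Or.inl ⟨h.1.symm, h.2.symm⟩)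
    (fun h => Or.inr ⟨h.2.1, h.1, h.2.2.symm⟩)⟩
  loopless := ⟨fun _ h => h.elim (fun h => G.loopless.irrefl _ h.2)
    (fun h => (pathGraph n).loopless.irrefl _ h.2.2)⟩

end SimpleGraph

/-!
Let `I` be the independence polynomial of a graph with nonnegative vertex weights, the weight of `u`
being multiplied by the variable `z`. Expand `z I'(z) I(y) - I(z) y I'(y)` as a sum over pairs
`(A, B)` of independent sets, each weighted by `|A| - |B|`. The symmetric difference of `A` and `B`
induces a bipartite graph, and `|A| - |B|` is the sum of `|P| - |Q|` over the bipartitions `(P, Q)`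
of its connected components. Grouping the terms by component gives a Christoffel-Darboux type
identity (`sum_card_sub_mul_prod`): the expression equals the sum, over the ordered bipartitions
`(P, Q)` of connected induced subgraphs, of `|P| - |Q|` times the weights of `P` at `z` and of `Q`
at `y` times `J(z) J(y)`, where `J` belongs to the graph without the closed neighbourhood of
`P ∪ Q`.

In a claw-free graph such a subgraph has maximum degree at most two, so `|P|` and `|Q|` differ by at
most one. Hence for `y = z̄` every term has an imaginary part which does not have the opposite sign
to that of `z`. If `z` is a non-real zero of `I`, the left-hand side vanishes and so does the
imaginary part of every term; the one with `P = {u}`, `Q = ∅`, for a vertex `u` of positive weight,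
says that `z` is also a zero for the graph without the closed neighbourhood of `u`, and induction
gives a contradiction (`IsClawFree.indepSum_ne_zero`). If all weights vanish, then `I = 1`.

For the concatenation let `a` and `b` be the parts of `I(G; z)` coming from the independent sets
that contain `v` and that do not. Then `I(P_n(G, v); z)` is the sum of `a ^ |T| b ^ (n - |T|)` over
the independent sets `T` of the path (`indepSum_concatenation`). For non-real `z` and `s ≥ 0` the
number `b + s a` is a weighted independence polynomial of `G`, hence nonzero. In particular `b ≠ 0`,
and at a zero `a / b` is a zero of the independence polynomial of the path. The path is claw-free,
so `a / b` is real, and it is negative because the coefficients are nonnegative with constant term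
`1`. Then `b + s a = 0` for `s = -b / a > 0`, a contradiction.
-/

namespace SimpleGraph

open Finset ComplexConjugate

variable {V : Type*}

/-! ### Claws -/

/-- A graph is claw-free when no vertex has three distinct pairwise non-adjacent neighbours. -/
theorem isClawFree_iff {G : SimpleGraph V} :
    G.IsClawFree ↔ ∀ a b c d, G.Adj a b → G.Adj a c → G.Adj a d → b ≠ c → b ≠ d → c ≠ d →
      ¬ G.Adj b c → ¬ G.Adj b d → G.Adj c d := by
  constructor
  · intro h a b c d hab hac had hbc hbd hcd nbc nbd
    by_contra ncd
    let f : Fin 1 ⊕ Fin 3 → V := Sum.elim (fun _ => a) ![b, c, d]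
    have hinj : f.Injective := by
      rintro (i | i) (j | j) hij
      · simp [Subsingleton.elim i j]
      · fin_cases j <;> simp_all [f]
      · fin_cases i <;> simp_all [f]
      · fin_cases i <;> fin_cases j <;> simp_all [f]
    have hadj (i j) : G.Adj (f i) (f j) ↔ (completeBipartiteGraph (Fin 1) (Fin 3)).Adj i j := by
      rcases i with i | i <;> rcases j with j | j
      · simp [f]
      · fin_cases j <;> simp [f, *]
      · fin_cases i <;> simp [f, hab.symm, hac.symm, had.symm]
      · fin_cases i <;> fin_cases j <;>
          simp [f, nbc, nbd, ncd, mt G.adj_symm nbc, mt G.adj_symm nbd, mt G.adj_symm ncd]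
    exact h ⟨⟨⟨f, hinj⟩, hadj _ _⟩⟩
  · rintro h ⟨f⟩
    have adj (j : Fin 3) : G.Adj (f (Sum.inl 0)) (f (Sum.inr j)) :=
      f.map_adj_iff.2 (by simp [completeBipartiteGraph])
    have nadj (i j : Fin 3) : ¬ G.Adj (f (Sum.inr i)) (f (Sum.inr j)) := fun hij => by
      simpa [completeBipartiteGraph] using f.map_adj_iff.1 hij
    have ne (i j : Fin 3) (hij : i ≠ j) : f (Sum.inr i) ≠ f (Sum.inr j) := fun he =>
      hij (Sum.inr_injective (f.injective he))
    exact nadj 1 2 (h _ _ _ _ (adj 0) (adj 1) (adj 2) (ne 0 1 (by decide)) (ne 0 2 (by decide))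
      (ne 1 2 (by decide)) (nadj 0 1) (nadj 0 2))

theorem pathGraph_isClawFree (n : ℕ) : (pathGraph n).IsClawFree := by
  rw [isClawFree_iff]
  intro a b c d hab hac had hbc hbd hcd
  rw [pathGraph_adj] at hab hac had
  rw [Ne, Fin.ext_iff] at hbc hbd hcd
  omega

/-- If `v` has two non-adjacent neighbours, then it is the centre of a claw in `P_n(G, v)`. -/
theorem concatenation_not_isClawFree {G : SimpleGraph V} {n : ℕ} (hn : 2 ≤ n) {v a b : V}
    (ha : G.Adj v a) (hb : G.Adj v b) (hne : a ≠ b) (hab : ¬ G.Adj a b) :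
    ¬ (concatenation n G v).IsClawFree := by
  rw [isClawFree_iff]
  intro h
  let i : Fin n := ⟨0, by omega⟩
  let j : Fin n := ⟨1, by omega⟩
  have hij : i ≠ j := by simp [i, j, Fin.ext_iff]
  have hadj : (pathGraph n).Adj i j := by simp [pathGraph_adj, i, j]
  have := h (i, v) (i, a) (i, b) (j, v) (by simp [concatenation, ha]) (by simp [concatenation, hb])
    (by simp [concatenation, hadj]) (by simp [hne]) (by simp [hij]) (by simp [hij])
    (by simp [concatenation, hab]) (by simp [concatenation, hij, ha.ne'])
  simp [concatenation, hij, hb.ne'] at this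

/-! ### Connected vertex sets -/

/-- `K` is a union of connected components of the subgraph of `G` induced on `S`. -/
def IsClosedIn (G : SimpleGraph V) (S K : Finset V) : Prop :=
  K ⊆ S ∧ ∀ a ∈ K, ∀ b ∈ S, b ∉ K → ¬ G.Adj a b

/-- The finite vertex set `H` is nonempty and induces a connected subgraph of `G`, expressed as:
`H` is not the union of two nonempty parts with no edge between them. -/
def IsConnSet (G : SimpleGraph V) (H : Finset V) : Prop :=
  H.Nonempty ∧ ∀ K, K.Nonempty → G.IsClosedIn H K → K = H

variable {G : SimpleGraph V}

theorem isConnSet_singleton (u : V) : G.IsConnSet {u} :=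
  ⟨singleton_nonempty u, fun _ hK h => (subset_singleton_iff.1 h.1).resolve_left hK.ne_empty⟩

theorem IsConnSet.eq_of_isClosedIn {S H K : Finset V} {u : V} (hH : G.IsConnSet H)
    (hK : G.IsConnSet K) (hHS : G.IsClosedIn S H) (hKS : G.IsClosedIn S K) (huH : u ∈ H)
    (huK : u ∈ K) : H = K := by
  classical
  have h1 : H ∩ K = H := hH.2 _ ⟨u, mem_inter.2 ⟨huH, huK⟩⟩
    ⟨inter_subset_left, fun a ha b hb hbn =>
      hKS.2 a (mem_inter.1 ha).2 b (hHS.1 hb) fun h => hbn (mem_inter.2 ⟨hb, h⟩)⟩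
  have h2 : H ∩ K = K := hK.2 _ ⟨u, mem_inter.2 ⟨huH, huK⟩⟩
    ⟨inter_subset_right, fun a ha b hb hbn =>
      hHS.2 a (mem_inter.1 ha).1 b (hKS.1 hb) fun h => hbn (mem_inter.2 ⟨h, hb⟩)⟩
  exact h1.symm.trans h2

theorem exists_isConnSet_isClosedIn {S : Finset V} {u : V} (hu : u ∈ S) :
    ∃ H, u ∈ H ∧ G.IsConnSet H ∧ G.IsClosedIn S H := by
  classical
  obtain ⟨H, hH, hmin⟩ := exists_min_image (S.powerset.filter fun K => u ∈ K ∧ G.IsClosedIn S K)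
    card ⟨S, by simpa [hu] using ⟨subset_rfl, fun _ _ b hb h => absurd hb h⟩⟩
  obtain ⟨-, huH, hHS⟩ := mem_filter.1 hH
  refine ⟨H, huH, ⟨⟨u, huH⟩, fun K hK hKH => ?_⟩, hHS⟩
  -- Both `K` and `H \ K` are closed in `S`; by minimality the one containing `u` is all of `H`.
  by_cases huK : u ∈ K
  · refine eq_of_subset_of_card_le hKH.1 (hmin K ?_)
    refine mem_filter.2 ⟨mem_powerset.2 (hKH.1.trans hHS.1), huK, hKH.1.trans hHS.1, ?_⟩
    intro a ha b hb hbK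
    by_cases hbH : b ∈ H
    · exact hKH.2 a ha b hbH hbK
    · exact hHS.2 a (hKH.1 ha) b hb hbH
  · have hle := hmin (H \ K) (mem_filter.2 ⟨mem_powerset.2 (sdiff_subset.trans hHS.1),
      mem_sdiff.2 ⟨huH, huK⟩, sdiff_subset.trans hHS.1, ?_⟩)
    · have := card_sdiff_add_card_eq_card hKH.1
      have := hK.card_pos
      omega
    · intro a ha b hb hbK
      rw [mem_sdiff] at ha hbK
      by_cases hbH : b ∈ H
      · have hbK' : b ∈ K := by tauto
        exact fun hadj => hKH.2 b hbK' a ha.1 ha.2 hadj.symm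
      · exact hHS.2 a ha.1 b hb hbH

/-- A connected set with bipartition `P ∪ Q` spans at least `|P ∪ Q| - 1` edges. -/
theorem IsConnSet.card_le_card_edges_add_one [DecidableEq V] [DecidableRel G.Adj] {P Q : Finset V}
    (hP : G.IsIndepSet (P : Set V)) (hQ : G.IsIndepSet (Q : Set V)) (hH : G.IsConnSet (P ∪ Q)) :
    #(P ∪ Q) ≤ #((P ×ˢ Q).filter fun e => G.Adj e.1 e.2) + 1 := by
  let E (K : Finset V) := (P ×ˢ Q).filter fun e => G.Adj e.1 e.2 ∧ e.1 ∈ K ∧ e.2 ∈ K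
  obtain ⟨u, hu⟩ := hH.1
  -- A largest vertex subset `K` spanning at least `|K| - 1` edges cannot be enlarged, so it is
  -- everything.
  obtain ⟨K, hK, hmax⟩ := exists_max_image
    ((P ∪ Q).powerset.filter fun K => K.Nonempty ∧ #K ≤ #(E K) + 1) card
    ⟨{u}, mem_filter.2 ⟨mem_powerset.2 (singleton_subset_iff.2 hu), singleton_nonempty u, by simp⟩⟩
  simp only [mem_filter, mem_powerset] at hK hmax
  obtain ⟨hKH, hKne, hKE⟩ := hK
  have hE : #(E K) ≤ #((P ×ˢ Q).filter fun e => G.Adj e.1 e.2) :=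
    card_le_card fun e he => by simp only [E, mem_filter] at he ⊢; tauto
  suffices K = P ∪ Q by rw [← this]; omega
  refine hH.2 K hKne ⟨hKH, fun a ha b hb hbK hadj => ?_⟩
  have hlt : #(E K) < #(E (insert b K)) := by
    refine card_lt_card ((ssubset_iff_of_subset ?_).2 ?_)
    · intro e he
      simp only [E, mem_filter, mem_insert] at he ⊢
      tauto
    · have haH := hKH ha
      rw [mem_union] at haH hb
      rcases haH with haP | haQ <;> rcases hb with hbP | hbQ
      · exact absurd hadj (hP haP hbP hadj.ne)
      · exact ⟨(a, b), by simp [E, haP, hbQ, hadj, ha], by simp [E, hbK]⟩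
      · exact ⟨(b, a), by simp [E, haQ, hbP, hadj.symm, ha], by simp [E, hbK]⟩
      · exact absurd hadj (hQ haQ hbQ hadj.ne)
  have := hmax (insert b K) ⟨insert_subset hb hKH, insert_nonempty _ _, by
    rw [card_insert_of_notMem hbK]; omega⟩
  rw [card_insert_of_notMem hbK] at this
  omega

/-- In a claw-free graph a connected set with bipartition `P ∪ Q` has maximum degree two, so it
spans at most `2 |Q|` edges. -/
theorem IsClawFree.card_le_card_add_one [DecidableEq V] (hG : G.IsClawFree) {P Q : Finset V}
    (hP : G.IsIndepSet (P : Set V)) (hQ : G.IsIndepSet (Q : Set V)) (hPQ : Disjoint P Q)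
    (hH : G.IsConnSet (P ∪ Q)) : #P ≤ #Q + 1 := by
  classical
  have h1 := hH.card_le_card_edges_add_one hP hQ
  have h2 : #((P ×ˢ Q).filter fun e => G.Adj e.1 e.2) ≤ 2 * #Q := by
    refine card_le_mul_card_image_of_maps_to (f := Prod.snd) (by simp +contextual) 2 fun q hq => ?_
    by_contra! hlt
    obtain ⟨⟨b, b'⟩, ⟨c, c'⟩, ⟨d, d'⟩, hb, hc, hd, hbc, hbd, hcd⟩ := two_lt_card_iff.1 hlt
    simp only [mem_filter, mem_product] at hb hc hd
    obtain ⟨⟨⟨hbP, -⟩, hb⟩, rfl⟩ := hb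
    obtain ⟨⟨⟨hcP, -⟩, hc⟩, rfl⟩ := hc
    obtain ⟨⟨⟨hdP, -⟩, hd⟩, rfl⟩ := hd
    have hbc' : b ≠ c := fun h => hbc (by rw [h])
    have hbd' : b ≠ d := fun h => hbd (by rw [h])
    have hcd' : c ≠ d := fun h => hcd (by rw [h])
    exact hP hcP hdP hcd' (isClawFree_iff.1 hG _ b c d hb.symm hc.symm hd.symm hbc' hbd' hcd'
      (hP hbP hcP hbc') (hP hbP hdP hbd'))
  rw [card_union_of_disjoint hPQ] at h1
  omega

/-! ### Weighted sums over independent sets -/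

open Classical in
/-- The independent sets of `G` contained in the finite set `S`. -/
noncomputable def indepSetsIn (G : SimpleGraph V) (S : Finset V) : Finset (Finset V) :=
  S.powerset.filter fun A => G.IsIndepSet (A : Set V)

/-- The multivariate independence polynomial of the subgraph of `G` induced on `S`, evaluated at
the vertex weights `x`: the sum of `∏ u ∈ A, x u` over the independent sets `A ⊆ S`. -/
noncomputable def indepSum {R : Type*} [CommRing R] (G : SimpleGraph V) (S : Finset V)
    (x : V → R) : R :=
  ∑ A ∈ G.indepSetsIn S, ∏ u ∈ A, x u

open Classical in
/-- The vertices of `S` outside the closed neighbourhood of `H`. -/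
noncomputable def farFrom (G : SimpleGraph V) (S H : Finset V) : Finset V :=
  S.filter fun u => u ∉ H ∧ ∀ h ∈ H, ¬ G.Adj h u

open Classical in
/-- The bipartitions `(P, Q)`, with `Q` possibly empty, of the connected bipartite induced subgraphs
of `G` on subsets of `S`. -/
noncomputable def connBipartitions (G : SimpleGraph V) (S : Finset V) :
    Finset (Finset V × Finset V) :=
  (G.indepSetsIn S ×ˢ G.indepSetsIn S).filter fun p =>
    Disjoint p.1 p.2 ∧ G.IsConnSet (p.1 ∪ p.2)

theorem mem_indepSetsIn {S A : Finset V} :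
    A ∈ G.indepSetsIn S ↔ A ⊆ S ∧ G.IsIndepSet (A : Set V) := by
  simp [indepSetsIn]

theorem mem_farFrom {S H : Finset V} {u : V} :
    u ∈ G.farFrom S H ↔ u ∈ S ∧ u ∉ H ∧ ∀ h ∈ H, ¬ G.Adj h u := by
  simp [farFrom]

theorem mem_connBipartitions [DecidableEq V] {S : Finset V} {p : Finset V × Finset V} :
    p ∈ G.connBipartitions S ↔ (p.1 ∈ G.indepSetsIn S ∧ p.2 ∈ G.indepSetsIn S) ∧
      Disjoint p.1 p.2 ∧ G.IsConnSet (p.1 ∪ p.2) := by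
  simp only [connBipartitions, mem_filter, mem_product]
  convert Iff.rfl

theorem swap_mem_connBipartitions {S : Finset V} {p : Finset V × Finset V} :
    p.swap ∈ G.connBipartitions S ↔ p ∈ G.connBipartitions S := by
  classical
  simp only [mem_connBipartitions, Prod.fst_swap, Prod.snd_swap, disjoint_comm (a := p.2),
    union_comm p.2, and_comm (a := p.2 ∈ _)]

/-- Removing a fixed part `P` from the independent sets whose remainder is far from `H`. -/
theorem sum_indepSetsIn_filter [DecidableEq V] {R : Type*} [CommRing R] {S H P : Finset V}
    [DecidablePred fun A => P ⊆ A ∧ A \ P ⊆ G.farFrom S H]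
    (hP : P ∈ G.indepSetsIn S) (hPH : P ⊆ H) (x : V → R) :
    ∑ A ∈ (G.indepSetsIn S).filter (fun A => P ⊆ A ∧ A \ P ⊆ G.farFrom S H), ∏ u ∈ A, x u =
      (∏ u ∈ P, x u) * G.indepSum (G.farFrom S H) x := by
  have hdisj {B : Finset V} (hB : B ⊆ G.farFrom S H) : Disjoint P B :=
    Finset.disjoint_left.2 fun u huP huB => (mem_farFrom.1 (hB huB)).2.1 (hPH huP)
  rw [mem_indepSetsIn] at hP
  rw [indepSum, mul_sum]
  refine sum_bij' (fun A _ => A \ P) (fun B _ => P ∪ B) ?_ ?_ ?_ ?_ ?_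
  · intro A hA
    rw [mem_filter, mem_indepSetsIn] at hA
    exact mem_indepSetsIn.2 ⟨hA.2.2, hA.1.2.mono (by simp)⟩
  · intro B hB
    rw [mem_indepSetsIn] at hB
    have hBP : (P ∪ B) \ P = B := union_sdiff_cancel_left (hdisj hB.1)
    refine mem_filter.2 ⟨mem_indepSetsIn.2 ⟨union_subset hP.1
      fun u hu => (mem_farFrom.1 (hB.1 hu)).1, ?_⟩, subset_union_left, by rw [hBP]; exact hB.1⟩
    have hPB : ∀ a ∈ P, ∀ b ∈ B, ¬ G.Adj a b := fun a ha b hb =>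
      (mem_farFrom.1 (hB.1 hb)).2.2 a (hPH ha)
    intro a ha b hb hab
    rw [mem_coe, mem_union] at ha hb
    rcases ha with ha | ha <;> rcases hb with hb | hb
    · exact hP.2 ha hb hab
    · exact hPB a ha b hb
    · exact fun h => hPB b hb a ha h.symm
    · exact hB.2 ha hb hab
  · intro A hA
    exact union_sdiff_of_subset (mem_filter.1 hA).2.1
  · intro B hB
    exact union_sdiff_cancel_left (hdisj (mem_indepSetsIn.1 hB).1)
  · intro A hA
    rw [mul_comm, prod_sdiff (mem_filter.1 hA).2.1]

/-! ### Decomposing a pair of independent sets into components -/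

open Classical in
/-- The bipartitions `(P, Q)` of the connected components of the subgraph induced on the symmetric
difference of the independent sets `A` and `B`, with `P ⊆ A` and `Q ⊆ B`. The component condition is
phrased as: what is left of `A` and of `B` lies outside the closed neighbourhood of `P ∪ Q`. -/
noncomputable def components (G : SimpleGraph V) (S A B : Finset V) :
    Finset (Finset V × Finset V) :=
  (G.connBipartitions S).filter fun p =>
    (p.1 ⊆ A ∧ A \ p.1 ⊆ G.farFrom S (p.1 ∪ p.2)) ∧ (p.2 ⊆ B ∧ B \ p.2 ⊆ G.farFrom S (p.1 ∪ p.2))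

theorem mem_components [DecidableEq V] {S A B : Finset V} {p : Finset V × Finset V} :
    p ∈ G.components S A B ↔ p ∈ G.connBipartitions S ∧
      (p.1 ⊆ A ∧ A \ p.1 ⊆ G.farFrom S (p.1 ∪ p.2)) ∧
      (p.2 ⊆ B ∧ B \ p.2 ⊆ G.farFrom S (p.1 ∪ p.2)) := by
  simp only [components, mem_filter]
  convert Iff.rfl

theorem swap_mem_components {S A B : Finset V} {p : Finset V × Finset V} :
    p.swap ∈ G.components S A B ↔ p ∈ G.components S B A := by
  classical
  simp only [mem_components, swap_mem_connBipartitions, Prod.fst_swap, Prod.snd_swap,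
    union_comm p.2]
  tauto

section
variable [DecidableEq V] {S A B : Finset V} {p q : Finset V × Finset V}

theorem inter_eq_of_mem_components (hp : p ∈ G.components S A B) : (p.1 ∪ p.2) ∩ A = p.1 := by
  obtain ⟨hp, ⟨hA, hA'⟩, -⟩ := mem_components.1 hp
  refine Subset.antisymm (fun u hu => ?_) (subset_inter subset_union_left hA)
  by_contra hup
  exact (mem_farFrom.1 (hA' (mem_sdiff.2 ⟨(mem_inter.1 hu).2, hup⟩))).2.1 (mem_inter.1 hu).1

theorem isClosedIn_of_mem_components (hp : p ∈ G.components S A B) :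
    G.IsClosedIn (A ∪ B) (p.1 ∪ p.2) := by
  obtain ⟨-, ⟨hA, hA'⟩, ⟨hB, hB'⟩⟩ := mem_components.1 hp
  refine ⟨union_subset_union hA hB, fun a ha b hb hbn => ?_⟩
  rw [mem_union, not_or] at hbn
  rcases mem_union.1 hb with hb | hb
  · exact (mem_farFrom.1 (hA' (mem_sdiff.2 ⟨hb, hbn.1⟩))).2.2 a ha
  · exact (mem_farFrom.1 (hB' (mem_sdiff.2 ⟨hb, hbn.2⟩))).2.2 a ha

theorem fst_eq_of_mem_components (hp : p ∈ G.components S A B) (hq : q ∈ G.components S A B)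
    {u : V} (hup : u ∈ p.1 ∪ p.2) (huq : u ∈ q.1 ∪ q.2) : p.1 = q.1 := by
  have h := (mem_connBipartitions.1 (mem_components.1 hp).1).2.2.eq_of_isClosedIn
    (mem_connBipartitions.1 (mem_components.1 hq).1).2.2
    (isClosedIn_of_mem_components hp) (isClosedIn_of_mem_components hq) hup huq
  rw [← inter_eq_of_mem_components hp, h, inter_eq_of_mem_components hq]

theorem eq_of_mem_components (hp : p ∈ G.components S A B) (hq : q ∈ G.components S A B)
    {u : V} (hup : u ∈ p.1 ∪ p.2) (huq : u ∈ q.1 ∪ q.2) : p = q := by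
  refine Prod.ext (fst_eq_of_mem_components hp hq hup huq) ?_
  rw [union_comm] at hup huq
  exact fst_eq_of_mem_components (p := p.swap) (q := q.swap) (swap_mem_components.2 hp)
    (swap_mem_components.2 hq) hup huq

theorem exists_mem_components (hA : A ∈ G.indepSetsIn S) (hB : B ∈ G.indepSetsIn S) {u : V}
    (hu : u ∈ A \ B) : ∃ p ∈ G.components S A B, u ∈ p.1 := by
  rw [mem_indepSetsIn] at hA hB
  obtain ⟨H, huH, hH, hHS⟩ := exists_isConnSet_isClosedIn (G := G) (S := symmDiff A B)
    (mem_symmDiff.2 (Or.inl (mem_sdiff.1 hu)))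
  have hHAB : H ∩ A ∪ H ∩ B = H := by
    rw [← inter_union_distrib_left]
    exact inter_eq_left.2 fun a ha => by
      have := mem_symmDiff.1 (hHS.1 ha)
      rw [mem_union]
      tauto
  have hfar {b : V} (hb : b ∈ A ∪ B) (hbH : b ∉ H) : b ∈ G.farFrom S H := by
    refine mem_farFrom.2 ⟨union_subset hA.1 hB.1 hb, hbH, fun a ha hadj => ?_⟩
    by_cases hbS : b ∈ symmDiff A B
    · exact hHS.2 a ha b hbS hbH hadj
    -- A vertex of `A ∩ B` has no neighbour in `A ∪ B`.
    · rw [mem_symmDiff] at hbS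
      rw [mem_union] at hb
      rcases mem_symmDiff.1 (hHS.1 ha) with h | h
      · exact hA.2 h.1 (by tauto : b ∈ A) hadj.ne hadj
      · exact hB.2 h.1 (by tauto : b ∈ B) hadj.ne hadj
  refine ⟨(H ∩ A, H ∩ B), mem_components.2 ⟨mem_connBipartitions.2 ⟨⟨?_, ?_⟩, ?_, ?_⟩,
    ⟨inter_subset_right, ?_⟩, inter_subset_right, ?_⟩, mem_inter.2 ⟨huH, (mem_sdiff.1 hu).1⟩⟩
  · exact mem_indepSetsIn.2 ⟨inter_subset_right.trans hA.1, hA.2.mono (by simp)⟩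
  · exact mem_indepSetsIn.2 ⟨inter_subset_right.trans hB.1, hB.2.mono (by simp)⟩
  · refine Finset.disjoint_left.2 fun a ha ha' => ?_
    have := mem_symmDiff.1 (hHS.1 (mem_inter.1 ha).1)
    have := (mem_inter.1 ha).2
    have := (mem_inter.1 ha').2
    tauto
  · simpa only [hHAB] using hH
  · intro b hb
    simp only [hHAB]
    simp only [mem_sdiff, mem_inter] at hb
    exact hfar (mem_union_left _ hb.1) (by tauto)
  · intro b hb
    simp only [hHAB]
    simp only [mem_sdiff, mem_inter] at hb
    exact hfar (mem_union_right _ hb.1) (by tauto)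

theorem sum_components_card_fst (hA : A ∈ G.indepSetsIn S) (hB : B ∈ G.indepSetsIn S) :
    ∑ p ∈ G.components S A B, #p.1 = #(A \ B) := by
  rw [← card_biUnion]
  · congr 1
    ext u
    rw [mem_biUnion]
    refine ⟨?_, exists_mem_components hA hB⟩
    rintro ⟨p, hp, hu⟩
    have hB := inter_eq_of_mem_components (swap_mem_components.2 hp : p.swap ∈ _)
    have hdisj := (mem_connBipartitions.1 (mem_components.1 hp).1).2.1
    refine mem_sdiff.2 ⟨(mem_components.1 hp).2.1.1 hu, fun huB => ?_⟩
    refine Finset.disjoint_left.1 hdisj hu ?_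
    change _ = p.2 at hB
    rw [← hB]
    exact mem_inter.2 ⟨mem_union_right _ hu, huB⟩
  · intro p hp q hq hpq
    exact Finset.disjoint_left.2 fun u hup huq => hpq
      (eq_of_mem_components hp hq (mem_union_left _ hup) (mem_union_left _ huq))

theorem sum_components_card_sub (hA : A ∈ G.indepSetsIn S) (hB : B ∈ G.indepSetsIn S) :
    ∑ p ∈ G.components S A B, ((#p.1 : ℤ) - #p.2) = #A - #B := by
  have h1 := sum_components_card_fst hA hB
  have h2 : ∑ p ∈ G.components S A B, #p.2 = #(B \ A) := by
    rw [← sum_components_card_fst hB hA]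
    exact sum_equiv (Equiv.prodComm _ _) (fun p => swap_mem_components.symm) fun _ _ => rfl
  have h3 := card_sdiff_add_card_inter A B
  have h4 := card_sdiff_add_card_inter B A
  rw [inter_comm] at h4
  rw [sum_sub_distrib, ← Nat.cast_sum, ← Nat.cast_sum, h1, h2]
  omega

/-- A Christoffel-Darboux type identity for independence polynomials. The left-hand side is
`(∂ I(x)) I(y) - I(x) (∂ I(y))` with `∂` the Euler operator, which multiplies the term of `A` by
`|A|`. -/
theorem sum_card_sub_mul_prod {R : Type*} [CommRing R] (S : Finset V) (x y : V → R) :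
    ∑ A ∈ G.indepSetsIn S, ∑ B ∈ G.indepSetsIn S,
      (((#A : ℤ) - #B : ℤ) : R) * ((∏ u ∈ A, x u) * ∏ u ∈ B, y u) =
    ∑ p ∈ G.connBipartitions S, (((#p.1 : ℤ) - #p.2 : ℤ) : R) *
      (((∏ u ∈ p.1, x u) * G.indepSum (G.farFrom S (p.1 ∪ p.2)) x) *
        ((∏ u ∈ p.2, y u) * G.indepSum (G.farFrom S (p.1 ∪ p.2)) y)) := by
  classical
  have hL : ∀ A ∈ G.indepSetsIn S, ∀ B ∈ G.indepSetsIn S,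
      (((#A : ℤ) - #B : ℤ) : R) * ((∏ u ∈ A, x u) * ∏ u ∈ B, y u) =
      ∑ p ∈ G.connBipartitions S,
        if (p.1 ⊆ A ∧ A \ p.1 ⊆ G.farFrom S (p.1 ∪ p.2)) ∧
            (p.2 ⊆ B ∧ B \ p.2 ⊆ G.farFrom S (p.1 ∪ p.2)) then
          (((#p.1 : ℤ) - #p.2 : ℤ) : R) * ((∏ u ∈ A, x u) * ∏ u ∈ B, y u) else 0 := by
    intro A hA B hB
    rw [← sum_components_card_sub hA hB, Int.cast_sum, sum_mul, ← sum_filter]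
    refine sum_congr ?_ fun _ _ => rfl
    ext p
    rw [mem_components, mem_filter]
  rw [sum_congr rfl fun A hA => (sum_congr rfl (hL A hA)).trans sum_comm, sum_comm]
  refine sum_congr rfl fun p hp => ?_
  obtain ⟨⟨hP, hQ⟩, -⟩ := mem_connBipartitions.1 hp
  rw [← sum_indepSetsIn_filter hP subset_union_left x,
    ← sum_indepSetsIn_filter hQ subset_union_right y, sum_mul_sum, mul_sum, sum_filter]
  refine sum_congr rfl fun A _ => ?_
  rw [mul_sum, sum_filter]
  by_cases hA : p.1 ⊆ A ∧ A \ p.1 ⊆ G.farFrom S (p.1 ∪ p.2)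
  · simp only [hA, true_and, if_true]
  · simp only [hA, false_and, if_false, sum_const_zero]

end

/-! ### Real zeros for claw-free graphs -/

theorem indepSum_conj (S : Finset V) (r : V → ℝ) (z : ℂ) :
    G.indepSum S (fun u => (r u : ℂ) * conj z) = conj (G.indepSum S fun u => (r u : ℂ) * z) := by
  simp [indepSum, map_sum, map_prod]

/-- If `I(x) = I(y) = 0`, then the pairs `(A, B)` of independent sets, weighted by `|A| - |B|`,
contribute `0` in total. -/
theorem sum_card_sub_mul_prod_eq_zero {R : Type*} [CommRing R] {S : Finset V} {x y : V → R}
    (hx : G.indepSum S x = 0) (hy : G.indepSum S y = 0) :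
    ∑ A ∈ G.indepSetsIn S, ∑ B ∈ G.indepSetsIn S,
      (((#A : ℤ) - #B : ℤ) : R) * ((∏ u ∈ A, x u) * ∏ u ∈ B, y u) = 0 := by
  have h : ∀ A B : Finset V, (((#A : ℤ) - #B : ℤ) : R) * ((∏ u ∈ A, x u) * ∏ u ∈ B, y u) =
      (#A * ∏ u ∈ A, x u) * (∏ u ∈ B, y u) - (∏ u ∈ A, x u) * (#B * ∏ u ∈ B, y u) := by
    intro A B
    push_cast
    ring
  simp only [h, sum_sub_distrib]
  rw [← sum_mul_sum, ← sum_mul_sum]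
  unfold indepSum at hx hy
  rw [hx, hy, mul_zero, zero_mul, sub_zero]

/-- For `|a - b| ≤ 1` the number `(a - b) z ^ a z̄ ^ b` is zero, or `|z| ^ (2 b) z`, or
`-|z| ^ (2 a) z̄`; in no case does its imaginary part have the sign opposite to that of `z`. -/
theorem im_mul_im_sub_mul_pow_nonneg {a b : ℕ} (hab : a ≤ b + 1) (hba : b ≤ a + 1) (z : ℂ) :
    0 ≤ z.im * ((((a : ℤ) - b : ℤ) : ℂ) * (z ^ a * conj z ^ b)).im := by
  have key (k : ℕ) : z ^ k * conj z ^ k = ((Complex.normSq z ^ k : ℝ) : ℂ) := by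
    rw [← mul_pow, Complex.mul_conj, Complex.ofReal_pow]
  have hnn (k : ℕ) : 0 ≤ Complex.normSq z ^ k := pow_nonneg (Complex.normSq_nonneg z) k
  obtain rfl | rfl | rfl : a = b ∨ a = b + 1 ∨ b = a + 1 := by omega
  · simp
  · have : (((b + 1 : ℕ) : ℤ) - b : ℤ) = 1 := by push_cast; ring
    rw [this, pow_succ, mul_right_comm, key, Int.cast_one, one_mul, Complex.im_ofReal_mul,
      mul_left_comm]
    exact mul_nonneg (hnn b) (mul_self_nonneg _)
  · have : ((a : ℤ) - (a + 1 : ℕ) : ℤ) = -1 := by push_cast; ring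
    rw [this, pow_succ, ← mul_assoc (z ^ a), key, Int.cast_neg, Int.cast_one, neg_one_mul,
      Complex.neg_im, Complex.im_ofReal_mul, Complex.conj_im, mul_neg, mul_neg, mul_neg, neg_neg,
      mul_left_comm]
    exact mul_nonneg (hnn a) (mul_self_nonneg _)

/-- The independence polynomial of a claw-free graph with nonnegative vertex weights has only real
zeros. Zero weights are allowed, so that vertices can be deleted by their weight. -/
theorem IsClawFree.indepSum_ne_zero (hG : G.IsClawFree) {r : V → ℝ} (hr : ∀ u, 0 ≤ r u) {z : ℂ}
    (hz : z.im ≠ 0) (S : Finset V) : G.indepSum S (fun u => (r u : ℂ) * z) ≠ 0 := by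
  classical
  induction S using Finset.strongInduction with
  | H S ih =>
  intro h0
  by_cases hS : ∃ u ∈ S, r u ≠ 0
  swap
  · -- All weights vanish, so only the empty set contributes.
    push Not at hS
    have h1 : G.indepSum S (fun u => (r u : ℂ) * z) = 1 := by
      rw [indepSum, sum_eq_single ∅]
      · simp
      · intro A hA hne
        obtain ⟨u, hu⟩ := nonempty_iff_ne_empty.2 hne
        exact prod_eq_zero hu (by simp [hS u ((mem_indepSetsIn.1 hA).1 hu)])
      · simp [mem_indepSetsIn, IsIndepSet]
    exact one_ne_zero (h1.symm.trans h0)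
  obtain ⟨u, huS, hu⟩ := hS
  have h0' : G.indepSum S (fun u => (r u : ℂ) * conj z) = 0 := by rw [indepSum_conj, h0, map_zero]
  have hsum := (sum_card_sub_mul_prod S _ _).symm.trans (sum_card_sub_mul_prod_eq_zero h0 h0')
  -- A nonnegative real number times `(|P| - |Q|) z ^ |P| z̄ ^ |Q|`.
  have hterm (p : Finset V × Finset V) : (((#p.1 : ℤ) - #p.2 : ℤ) : ℂ) *
      (((∏ u ∈ p.1, (r u : ℂ) * z) * G.indepSum (G.farFrom S (p.1 ∪ p.2)) fun u => (r u : ℂ) * z) *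
        ((∏ u ∈ p.2, (r u : ℂ) * conj z) *
          G.indepSum (G.farFrom S (p.1 ∪ p.2)) fun u => (r u : ℂ) * conj z)) =
      (((∏ u ∈ p.1, r u) * (∏ u ∈ p.2, r u) * Complex.normSq
        (G.indepSum (G.farFrom S (p.1 ∪ p.2)) fun u => (r u : ℂ) * z) : ℝ) : ℂ) *
      ((((#p.1 : ℤ) - #p.2 : ℤ) : ℂ) * (z ^ #p.1 * conj z ^ #p.2)) := by
    rw [indepSum_conj]
    simp only [prod_mul_distrib, prod_const, Complex.ofReal_mul, Complex.ofReal_prod,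
      ← Complex.mul_conj]
    ring
  rw [sum_congr rfl fun p _ => hterm p] at hsum
  have him := congrArg (fun w : ℂ => z.im * w.im) hsum
  simp only [Complex.im_sum, Complex.im_ofReal_mul, mul_sum, Complex.zero_im, mul_zero] at him
  rw [sum_eq_zero_iff_of_nonneg] at him
  · have hmem : ({u}, ∅) ∈ G.connBipartitions S := mem_connBipartitions.2
      ⟨⟨mem_indepSetsIn.2 ⟨singleton_subset_iff.2 huS, by simp [IsIndepSet]⟩,
        mem_indepSetsIn.2 ⟨empty_subset _, by simp [IsIndepSet]⟩⟩, by simp,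
        by simpa using isConnSet_singleton u⟩
    have h := him _ hmem
    simp [hz, hu] at h
    refine ih _ ?_ h
    refine ⟨fun w hw => (mem_farFrom.1 hw).1, fun hss => ?_⟩
    exact (mem_farFrom.1 (hss huS)).2.1 (mem_singleton_self u)
  · intro p hp
    rw [mem_connBipartitions] at hp
    obtain ⟨⟨hP, hQ⟩, hdisj, hconn⟩ := hp
    rw [mem_indepSetsIn] at hP hQ
    rw [mul_left_comm]
    refine mul_nonneg (mul_nonneg (mul_nonneg (prod_nonneg fun _ _ => hr _)
      (prod_nonneg fun _ _ => hr _)) (Complex.normSq_nonneg _)) (im_mul_im_sub_mul_pow_nonneg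
        (hG.card_le_card_add_one hP.2 hQ.2 hdisj hconn)
        (hG.card_le_card_add_one hQ.2 hP.2 hdisj.symm (by rwa [union_comm])) z)

/-! ### Concatenations -/

theorem aeval_indepPoly [Fintype V] (G : SimpleGraph V) (z : ℂ) :
    Polynomial.aeval z G.indepPoly = G.indepSum univ fun _ => z := by
  classical
  have hmap : ∀ A ∈ G.indepSetsIn univ, #A ∈ range (G.indepNum + 1) := fun A hA =>
    mem_range.2 (Nat.lt_succ_of_le (mem_indepSetsIn.1 hA).2.card_le_indepNum)
  rw [indepSum, ← sum_fiberwise_of_maps_to hmap, indepPoly, map_sum]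
  refine sum_congr rfl fun k _ => ?_
  have hset : (G.indepSetsIn univ).filter (fun A => #A = k) = G.indepSetFinset k := by
    ext A
    simp [mem_indepSetsIn, mem_indepSetFinset_iff, isNIndepSet_iff]
  rw [sum_congr rfl (g := fun _ => z ^ k) fun A hA => by
    rw [prod_const, (mem_filter.1 hA).2], hset, sum_const]
  simp

/-- An independent set of `P_n(G, v)` amounts to an independent set `T` of the path, the positions
whose part contains the vertex `v`, together with an independent set of each copy of `G` which
contains `v` exactly at the positions in `T`. -/
theorem indepSum_concatenation [Fintype V] [DecidableEq V] (n : ℕ) (G : SimpleGraph V) (v : V)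
    (z : ℂ) :
    (concatenation n G v).indepSum univ (fun _ => z) =
      ∑ T ∈ (pathGraph n).indepSetsIn univ, ∏ i, if i ∈ T then
        ∑ A ∈ G.indepSetsIn univ with v ∈ A, z ^ #A else
        ∑ A ∈ G.indepSetsIn univ with v ∉ A, z ^ #A := by
  classical
  have h1 (T : Finset (Fin n)) : (∏ i, if i ∈ T then
        ∑ A ∈ G.indepSetsIn univ with v ∈ A, z ^ #A else
        ∑ A ∈ G.indepSetsIn univ with v ∉ A, z ^ #A) =
      ∑ f ∈ Fintype.piFinset fun i => (G.indepSetsIn univ).filter fun A => v ∈ A ↔ i ∈ T,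
        ∏ i, z ^ #(f i) := by
    rw [← prod_univ_sum (fun i => (G.indepSetsIn univ).filter fun A => v ∈ A ↔ i ∈ T)
      fun _ A => z ^ #A]
    refine prod_congr rfl fun i _ => ?_
    split_ifs with h <;> simp [h]
  simp only [h1]
  rw [sum_sigma', indepSum]
  symm
  refine sum_bij' (fun s _ => univ.filter fun p : Fin n × V => p.2 ∈ s.2 p.1)
    (fun F _ => ⟨univ.filter fun i => (i, v) ∈ F, fun i => univ.filter fun u => (i, u) ∈ F⟩)
    ?_ ?_ ?_ ?_ ?_
  · rintro ⟨T, f⟩ h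
    simp only [mem_sigma, Fintype.mem_piFinset, mem_filter, mem_indepSetsIn, subset_univ,
      true_and] at h ⊢
    rintro ⟨i, a⟩ ha ⟨j, b⟩ hb hne hadj
    simp only [coe_filter, mem_univ, true_and, Set.mem_ofPred_eq] at ha hb
    rcases hadj with ⟨hij, hab⟩ | ⟨hav, hbv, hij⟩
    · dsimp only at hij hab
      subst hij
      exact (h.2 i).1 ha hb hab.ne hab
    · dsimp only at hav hbv hij
      subst hav hbv
      exact h.1 (((h.2 i).2).1 ha) (((h.2 j).2).1 hb) hij.ne hij
  · intro F hF
    simp only [mem_sigma, Fintype.mem_piFinset, mem_filter, mem_indepSetsIn, subset_univ,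
      true_and, mem_univ, iff_self, and_true] at hF ⊢
    refine ⟨fun i hi j hj hne hadj => ?_, fun i a ha b hb hne hadj => ?_⟩
    · simp only [coe_filter, mem_univ, true_and, Set.mem_ofPred_eq] at hi hj
      exact hF hi hj (by simp [hne]) (Or.inr ⟨rfl, rfl, hadj⟩)
    · simp only [coe_filter, mem_univ, true_and, Set.mem_ofPred_eq] at ha hb
      exact hF ha hb (by simp [hne]) (Or.inl ⟨rfl, hadj⟩)
  · rintro ⟨T, f⟩ h
    simp only [mem_sigma, Fintype.mem_piFinset, mem_filter] at h
    have hT : (univ.filter fun i => v ∈ f i) = T := by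
      ext i
      simp [(h.2 i).2]
    simp [hT]
  · intro F hF
    ext ⟨i, a⟩
    simp
  · rintro ⟨T, f⟩ h
    rw [prod_const, prod_pow_eq_pow_sum]
    congr 1
    rw [← card_sigma]
    refine card_bij' (fun q _ => (q.1, q.2)) (fun p _ => ⟨p.1, p.2⟩) ?_ ?_ ?_ ?_ <;> simp

theorem IsClawFree.im_eq_zero_of_concatenation [Fintype V] (hG : G.IsClawFree) (v : V) (n : ℕ)
    {z : ℂ} (h : Polynomial.aeval z (concatenation n G v).indepPoly = 0) : z.im = 0 := by
  classical
  by_contra hz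
  rw [aeval_indepPoly, indepSum_concatenation] at h
  set a := ∑ A ∈ G.indepSetsIn univ with v ∈ A, z ^ #A
  set b := ∑ A ∈ G.indepSetsIn univ with v ∉ A, z ^ #A
  -- `b + s a` is the independence polynomial of `G` with the weight of `v` multiplied by `s`.
  have hne (s : ℝ) (hs : 0 ≤ s) : b + s * a ≠ 0 := by
    have hw := hG.indepSum_ne_zero (r := fun u => if u = v then s else 1)
      (fun u => by split_ifs <;> simp [hs]) hz univ
    convert hw using 1
    rw [indepSum, ← sum_filter_add_sum_filter_not _ (fun A => v ∈ A), add_comm, mul_sum]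
    congr 1
    · refine sum_congr rfl fun A hA => ?_
      have hv := (mem_filter.1 hA).2
      rw [prod_mul_distrib, prod_const]
      simp [apply_ite, prod_ite_eq', hv]
    · refine sum_congr rfl fun A hA => ?_
      have hv := (mem_filter.1 hA).2
      rw [prod_mul_distrib, prod_const]
      simp [apply_ite, prod_ite_eq', hv]
  have hb : b ≠ 0 := by simpa using hne 0 le_rfl
  set t := a / b with ht
  have ha : a = b * t := by rw [ht]; field_simp
  have hpath : (pathGraph n).indepSum univ (fun _ => t) = 0 := by
    refine (mul_eq_zero.1 ?_).resolve_left (pow_ne_zero n hb)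
    rw [← h, indepSum, mul_sum]
    refine sum_congr rfl fun T _ => ?_
    have hi (i : Fin n) : (if i ∈ T then a else b) = b * if i ∈ T then t else 1 := by
      split_ifs
      · exact ha
      · exact (mul_one b).symm
    rw [prod_congr rfl fun i _ => hi i, prod_mul_distrib]
    simp
  have him : t.im = 0 := by
    by_contra him
    refine (pathGraph_isClawFree n).indepSum_ne_zero (r := fun _ => 1) (by simp) him univ ?_
    simpa using hpath
  obtain ⟨s, hs⟩ : ∃ s : ℝ, (s : ℂ) = t := ⟨t.re, Complex.ext rfl (by simp [him])⟩
  have hneg : s < 0 := by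
    by_contra! h0
    have hpos : 0 < (pathGraph n).indepSum univ (fun _ => s) := by
      refine sum_pos' (fun T _ => prod_nonneg fun _ _ => h0) ⟨∅, ?_, by simp⟩
      simp [mem_indepSetsIn, IsIndepSet]
    refine hpos.ne' ?_
    rw [← hs] at hpath
    have : (((pathGraph n).indepSum univ (fun _ => s) : ℝ) : ℂ) = 0 := by
      rw [← hpath]
      simp [indepSum]
    exact_mod_cast this
  refine hne (-s⁻¹) (by simpa using hneg.le) ?_
  rw [ha, ← hs]
  have : (s : ℂ) ≠ 0 := by exact_mod_cast hneg.ne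
  push_cast
  field_simp
  ring

end SimpleGraph

theorem mainTheorem4 :
    (∀ {V : Type*} [Fintype V] (G : SimpleGraph V) (v : V) (n : ℕ), G.IsClawFree →
      ∀ z : ℂ, Polynomial.aeval z (SimpleGraph.concatenation n G v).indepPoly = 0 → z.im = 0) ∧
    (∀ n : ℕ, 2 ≤ n → ∃ (m : ℕ) (H : SimpleGraph (Fin m)) (w : Fin m), H.IsClawFree ∧
      ¬ (SimpleGraph.concatenation n H w).IsClawFree) := by
  refine ⟨fun G v n hG z hz => hG.im_eq_zero_of_concatenation v n hz, fun n hn =>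
    ⟨3, SimpleGraph.pathGraph 3, 1, SimpleGraph.pathGraph_isClawFree 3, ?_⟩⟩
  -- The middle vertex of the path with three vertices has two non-adjacent neighbours.
  exact SimpleGraph.concatenation_not_isClawFree hn (a := 0) (b := 2)
    (by simp [SimpleGraph.pathGraph_adj]) (by simp [SimpleGraph.pathGraph_adj]) (by decide)
    (by simp [SimpleGraph.pathGraph_adj])
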